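/- Let $K$ be a field, $n\ge 0$, $R=K[x_1,\dots,x_n]$, and let $\Delta$ be a simplicial complex on the vertex set $\{1,\dots,n\}$, i.e. a collection of subsets of $\{1,\dots,n\}$ that contains $\emptyset$ and every $\{i\}$ and is closed under taking subsets. The facets of $\Delta$ are its maximal faces. A chain between two facets $F,G$ is a sequence of facets $F=F_0,\dots,F_k=G$ with $F_{i}\cap F_{i+1}\ne\emptyset$ for all $i<k$; a complex is connected if any two of its facets are joined by a chain of its facets. A subcomplex of $\Delta$ means a complex all of whose facets are facets of $\Delta$. A facet $F$ of a complex is a leaf if it is the only facet, or if there is a facet $G\neq F$ with $F\cap H\subseteq F\cap G$ for every facet $H\ne F$. A connected complex is a tree if every nonempty subcomplex has a leaf, and a complex is a forest if each of its connected components is a tree. The facet ideal of $\Delta$ is the ideal $I\subset R$ generated by the monomials $\prod_{i\in F}x_i$, $F$ a facet of $\Delta$. For an ideal $I\subset R$ let $K_\bullet(R/I)$ be the Koszul complex of $R/I$ with respect to $x_1,\dots,x_n$, with basis elements $e_L=e_{i_1}\wedge\dots\wedge e_{i_r}$ for $L=\{i_1<\dots<i_r\}\subseteq\{1,\dots,n\}$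 over $R/I$, and let $H_r(R/I)$ be its $r$-th homology. A monomial cycle of degree $r$ is a cycle of the form $f e_L$ with $f$ (the residue class of) a monomial of $R$ and $|L|=r$. Let $\mathcal M_r\subseteq H_r(R/I)$ be the set of homology classes of the monomial cycles of degree $r$. **Proposition.** Let $\Delta$ be a forest and $I$ its facet ideal. Then for every $r\ge 0$ the $K$-vector space $H_r(R/I)$ has a $K$-basis consisting of homology classes of monomial cycles. More precisely, $\mathcal M_r$ is a $K$-basis of $H_r(R/I)$ up to zero and sign: there is a $K$-basis $B\subseteq\mathcal M_r$ of $H_r(R/I)$ such that every $v\in\mathcal M_r$ satisfies $v=0$, $v\in B$ or $-v\in B$. -/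

import Mathlib

open MvPolynomial

namespace FacetIdeal

/-! ### Facets, trees and forests -/

/-- The facets of a simplicial complex: its maximal faces under inclusion. The empty set is counted as
a face of every simplicial complex, whereas `Δ.faces` lists the nonempty ones only. -/
def facets {V : Type*} (Δ : AbstractSimplicialComplex V) : Set (Finset V) :=
  {F | Maximal (fun G : Finset V => G = ∅ ∨ G ∈ Δ.faces) F}

/-! A subcomplex `⟨F₁, …, F_q⟩` of `Δ` is a complex all of whose facets are facets of `Δ`; it is
determined by its set of facets, and every nonempty set of facets of `Δ` is the set of facets of the
subcomplex that it generates. The notions below are therefore stated for sets `S` of facets. -/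

/-- `F` is a leaf of the complex with set of facets `S`. -/
def IsLeaf {V : Type*} [DecidableEq V] (S : Set (Finset V)) (F : Finset V) : Prop :=
  F ∈ S ∧ ((∀ G ∈ S, G = F) ∨ ∃ G ∈ S, G ≠ F ∧ ∀ H ∈ S, H ≠ F → F ∩ H ⊆ F ∩ G)

/-- There is a chain `F = F₀, …, F_k = G` in `S` in which consecutive members intersect. -/
def Linked {V : Type*} [DecidableEq V] (S : Set (Finset V)) (F G : Finset V) : Prop :=
  Relation.ReflTransGen (fun A B : Finset V => A ∈ S ∧ B ∈ S ∧ (A ∩ B).Nonempty) F G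

/-- The complex with set of facets `S` is connected. -/
def IsConnected {V : Type*} [DecidableEq V] (S : Set (Finset V)) : Prop :=
  ∀ F ∈ S, ∀ G ∈ S, Linked S F G

/-- The complex with set of facets `S` is a tree: it is connected and every nonempty subcomplex has
a leaf. -/
def IsTree {V : Type*} [DecidableEq V] (S : Set (Finset V)) : Prop :=
  IsConnected S ∧ ∀ T : Set (Finset V), T ⊆ S → T.Nonempty → ∃ F, IsLeaf T F

/-- The set of facets of the connected component of `F`. -/
def component {V : Type*} [DecidableEq V] (S : Set (Finset V)) (F : Finset V) : Set (Finset V) :=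
  {G | G ∈ S ∧ Linked S F G}

/-- A simplicial complex is a forest if each of its connected components is a tree. -/
def IsForest {V : Type*} [DecidableEq V] (Δ : AbstractSimplicialComplex V) : Prop :=
  ∀ F ∈ facets Δ, IsTree (component (facets Δ) F)

/-- The facet ideal: generated by the squarefree monomials `∏ i ∈ F, xᵢ`, `F` a facet. -/
noncomputable def facetIdeal (K : Type*) [Field K] {n : ℕ} (Δ : AbstractSimplicialComplex (Fin n)) :
    Ideal (MvPolynomial (Fin n) K) :=
  Ideal.span {f | ∃ F ∈ facets Δ, f = ∏ i ∈ F, X i}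

/-! ### The Koszul complex of a module over `K[x₁, …, xₙ]` with respect to `x₁, …, xₙ`

The total module `K_•(M) = ⨁_L M e_L`, `L ⊆ {1, …, n}`, is realized as `Finset (Fin n) → M`; here
`e_L = e_{i₁} ∧ ⋯ ∧ e_{iᵣ}` for `L = {i₁ < ⋯ < iᵣ}`, and `m e_L` is `Pi.single L m`. -/

section Koszul

variable (K : Type*) [Field K] (n : ℕ) (M : Type*) [AddCommGroup M]
  [Module (MvPolynomial (Fin n) K) M]

/-- The Koszul differential, determined by
`d(m e_L) = ∑_{j ∈ L} (-1)^{#{i ∈ L : i < j}} x_j m e_{L \ {j}}`. -/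
noncomputable def koszulD :
    (Finset (Fin n) → M) →ₗ[MvPolynomial (Fin n) K] (Finset (Fin n) → M) :=
  ∑ L : Finset (Fin n), ∑ j ∈ L,
    ((-1) ^ (L.filter (· < j)).card * X j : MvPolynomial (Fin n) K) •
      (LinearMap.single (MvPolynomial (Fin n) K) (fun _ : Finset (Fin n) => M) (L.erase j) ∘ₗ
        LinearMap.proj L)

/-- `K_r(M) = ⨁_{|L| = r} M e_L`. -/
def koszulDegree (r : ℕ) : Submodule (MvPolynomial (Fin n) K) (Finset (Fin n) → M) where
  carrier := {z | ∀ L, L.card ≠ r → z L = 0}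
  zero_mem' := fun _ _ => rfl
  add_mem' := fun {y z} hy hz L hL => by simp [hy L hL, hz L hL]
  smul_mem' := fun c z hz L hL => by simp [hz L hL]

/-- The Koszul cycles `Z_r(M)`. -/
noncomputable def koszulCycles (r : ℕ) :
    Submodule (MvPolynomial (Fin n) K) (Finset (Fin n) → M) :=
  koszulDegree K n M r ⊓ LinearMap.ker (koszulD K n M)

/-- The Koszul boundaries `B_r(M) = d(K_{r+1}(M))`. -/
noncomputable def koszulBoundaries (r : ℕ) :
    Submodule (MvPolynomial (Fin n) K) (Finset (Fin n) → M) :=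
  (koszulDegree K n M (r + 1)).map (koszulD K n M)

/-- The Koszul homology `H_r(M) = Z_r(M) / B_r(M)`. -/
abbrev KoszulHomology (r : ℕ) : Type _ :=
  koszulCycles K n M r ⧸ (koszulBoundaries K n M r).submoduleOf (koszulCycles K n M r)

theorem koszulD_single (L : Finset (Fin n)) (m : M) :
    koszulD K n M (Pi.single L m) = ∑ j ∈ L, Pi.single (L.erase j)
      (((-1) ^ (L.filter (· < j)).card * X j : MvPolynomial (Fin n) K) • m) := by
  classical
  unfold koszulD
  rw [LinearMap.sum_apply, Finset.sum_eq_single L]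
  · rw [LinearMap.sum_apply]
    refine Finset.sum_congr rfl fun j _ => ?_
    simp only [LinearMap.smul_apply, LinearMap.comp_apply, LinearMap.proj_apply, Pi.single_eq_same,
      LinearMap.single_apply, Pi.single_smul]
  · intro L' _ h
    rw [LinearMap.sum_apply]
    refine Finset.sum_eq_zero fun j _ => ?_
    simp [Pi.single_eq_of_ne h]
  · simp

theorem koszulD_comp_koszulD (z : Finset (Fin n) → M) : koszulD K n M (koszulD K n M z) = 0 := by
  classical
  suffices h : koszulD K n M ∘ₗ koszulD K n M = 0 from LinearMap.congr_fun h z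
  refine LinearMap.pi_ext fun L m => ?_
  simp only [LinearMap.comp_apply, koszulD_single, map_sum, LinearMap.zero_apply]
  rw [Finset.sum_sigma']
  refine Finset.sum_involution (fun p _ => ⟨p.2, p.1⟩) ?_ ?_ ?_ ?_
  · rintro ⟨j, k⟩ h
    simp only [Finset.mem_sigma, Finset.mem_erase] at h
    obtain ⟨hj, hkj, hk⟩ := h
    have key : ∀ a b : Fin n, a ∈ L → a < b →
        (L.filter (· < b)).card = ((L.erase a).filter (· < b)).card + 1 ∧
        ((L.erase b).filter (· < a)).card = (L.filter (· < a)).card := by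
      intro a b ha hab
      constructor
      · rw [Finset.filter_erase, Finset.card_erase_add_one]
        simp [ha, hab]
      · rw [Finset.filter_erase, Finset.erase_eq_of_notMem]
        simp [hab.le]
    dsimp only
    rw [Finset.erase_right_comm, ← Pi.single_add, smul_smul, smul_smul, ← add_smul,
      Pi.single_eq_zero_iff]
    refine (congrArg (· • m) ?_).trans (zero_smul (MvPolynomial (Fin n) K) m)
    rcases lt_or_gt_of_ne hkj with h | h
    · obtain ⟨h1, h2⟩ := key k j hk h
      rw [h1, h2]; ring
    · obtain ⟨h1, h2⟩ := key j k hj h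
      rw [h1, h2]; ring
  · rintro ⟨j, k⟩ h _ he
    simp only [Finset.mem_sigma, Finset.mem_erase] at h
    simp only [Sigma.mk.injEq, heq_eq_eq] at he
    exact h.2.1 he.1
  · rintro ⟨j, k⟩ h
    simp only [Finset.mem_sigma, Finset.mem_erase] at h ⊢
    exact ⟨h.2.2, h.2.1.symm, h.1⟩
  · rintro ⟨j, k⟩ _
    rfl

theorem koszulBoundaries_le_koszulCycles (r : ℕ) :
    koszulBoundaries K n M r ≤ koszulCycles K n M r := by
  classical
  rintro _ ⟨z, hz, rfl⟩
  refine ⟨fun T hT => ?_, koszulD_comp_koszulD K n M z⟩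
  simp only [koszulD, LinearMap.sum_apply, LinearMap.smul_apply, LinearMap.comp_apply,
    LinearMap.proj_apply, LinearMap.single_apply, Finset.sum_apply, Pi.smul_apply]
  refine Finset.sum_eq_zero fun L _ => Finset.sum_eq_zero fun j hj => ?_
  by_cases hL : L.card = r + 1
  · rw [Pi.single_eq_of_ne, smul_zero]
    rintro rfl
    exact hT (by rw [Finset.card_erase_of_mem hj, hL]; rfl)
  · simp [hz L hL]

end Koszul

/-- The set `M_r` of homology classes `[f e_{i₁} ∧ ⋯ ∧ e_{iᵣ}]` in `H_r(R/I)` of the monomial cycles,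
i.e. of the cycles of the form `f e_L` with `f` a monomial and `L = {i₁ < ⋯ < iᵣ}`. -/
def monomialCycleClasses {K : Type*} [Field K] {n : ℕ} (I : Ideal (MvPolynomial (Fin n) K)) (r : ℕ) :
    Set (KoszulHomology K n (MvPolynomial (Fin n) K ⧸ I) r) :=
  {v | ∃ (a : Fin n →₀ ℕ) (L : Finset (Fin n))
      (z : koszulCycles K n (MvPolynomial (Fin n) K ⧸ I) r),
    L.card = r ∧
    (z : Finset (Fin n) → MvPolynomial (Fin n) K ⧸ I) =
      Pi.single L (Ideal.Quotient.mk I (monomial a 1)) ∧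
    v = Submodule.Quotient.mk z}

end FacetIdeal

/-! The Koszul complex of `R/I` splits by multidegree, where `x^b e_L` has multidegree `b + 1_L`. In
multidegree `a` the complex of `R` has one basis element `(x^a / x_L) e_L` for each `L ⊆ supp a`: it
is the augmented chain complex of the full simplex on `supp a`. The part from `I` is spanned by
those `L` that miss `F ∩ {i : a i = 1}` for some facet `F ⊆ supp a`. So each strand of `H(R/I)` is
the homology of a simplex relative to the sets missing a member of some family.

If every subfamily has a leaf, this relative homology, all degrees together, is spanned by one class
`[e_L₀]`, possibly zero, and every cycle `e_L` has class `0` or `±[e_L₀]`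
(`hasMonomialGenerator_nonCovers`). The proof removes a leaf `F`. Unless some other member contains
`F`, the leaf has a vertex `u` in no other member; the sets missing one of the others then form a
cone with apex `u`, and the connecting map identifies the homology with that of the traces of the
other members off `F`, one degree lower (`HasMonomialGenerator.union`).

The property of having leaves passes to traces (`HasLeaves.image_inter`) and holds for the facets of
a forest (`IsForest.hasLeaves`). The nonzero generators of degree `r`, over all multidegrees, form
the basis. -/

namespace FacetIdeal

/-! ### Signs of the simplicial differential -/

section Simplex

variable {K : Type*} [Field K] {V : Type*} [LinearOrder V]

/-- The sign `(-1)^{#{i ∈ T : i < j}}`. -/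
def koszulSign (K : Type*) [Ring K] {V : Type*} [LinearOrder V] (j : V) (T : Finset V) : K :=
  (-1) ^ (T.filter (· < j)).card

theorem koszulSign_mul_self (j : V) (T : Finset V) :
    koszulSign K j T * koszulSign K j T = 1 := by
  unfold koszulSign
  rw [← mul_pow]; simp

theorem koszulSign_insert_of_lt {i j : V} {T : Finset V} (hi : i ∉ T) (h : i < j) :
    koszulSign K j (insert i T) = -koszulSign K j T := by
  unfold koszulSign
  rw [Finset.filter_insert, if_pos h, Finset.card_insert_of_notMem (by simp [hi])]
  ring

theorem koszulSign_insert_of_gt {i j : V} {T : Finset V} (h : j < i) :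
    koszulSign K j (insert i T) = koszulSign K j T := by
  unfold koszulSign
  rw [Finset.filter_insert, if_neg h.not_gt]

theorem koszulSign_swap {i j : V} {T : Finset V} (hi : i ∉ T) (hj : j ∉ T) (hij : i ≠ j) :
    koszulSign K j (insert i T) * koszulSign K i (insert j T) =
      -(koszulSign K i T * koszulSign K j T) := by
  rcases lt_or_gt_of_ne hij with h | h
  · rw [koszulSign_insert_of_lt hi h, koszulSign_insert_of_gt h]; ring
  · rw [koszulSign_insert_of_lt hj h, koszulSign_insert_of_gt h]; ring

theorem koszulSign_eq (j : V) (T : Finset V) : koszulSign K j T = 1 ∨ koszulSign K j T = -1 :=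
  neg_one_pow_eq_or _ _

/-! ### Set families with leaves -/

/-- Every nonempty subfamily of `S` has a leaf. -/
def HasLeaves (S : Set (Finset V)) : Prop :=
  ∀ T : Set (Finset V), T ⊆ S → T.Nonempty → ∃ F, IsLeaf T F

theorem HasLeaves.mono {S T : Set (Finset V)} (hS : HasLeaves S) (h : T ⊆ S) : HasLeaves T :=
  fun U hU => hS U (hU.trans h)

/-- Choosing one preimage for each trace makes distinct traces come from distinct sets; the trace of
a leaf of the chosen sets is then a leaf, since the inclusions `F ∩ H ⊆ F ∩ G` survive intersection
with `A`. -/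
theorem HasLeaves.image_inter {S : Set (Finset V)} (hS : HasLeaves S) (A : Finset V) :
    HasLeaves ((· ∩ A) '' S) := by
  intro T hT hne
  have hT' : ∀ P ∈ T, ∃ Q ∈ S, Q ∩ A = P := fun P hP => hT hP
  choose! g hg using hT'
  obtain ⟨F, ⟨P, hP, rfl⟩, hF⟩ := hS (g '' T) (by rintro _ ⟨P, hP, rfl⟩; exact (hg P hP).1)
    (hne.image g)
  have hgA : ∀ P ∈ T, g P ∩ A = P := fun P hP => (hg P hP).2
  refine ⟨P, hP, ?_⟩
  rcases hF with hF | ⟨_, ⟨Q, hQ, rfl⟩, hQP, hF⟩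
  · left
    intro G hG
    rw [← hgA G hG, ← hgA P hP, hF (g G) ⟨G, hG, rfl⟩]
  · right
    refine ⟨Q, hQ, by rintro rfl; exact hQP rfl, fun H hH hHP => ?_⟩
    have := hF (g H) ⟨H, hH, rfl⟩ fun h => hHP (by rw [← hgA H hH, ← hgA P hP, h])
    rw [← hgA H hH, ← hgA P hP, ← hgA Q hQ]
    intro i hi
    have h' := @this i
    simp only [Finset.mem_inter] at hi h' ⊢
    tauto

/-- The subsets of `W` that miss a member of `S`. -/
def nonCovers (W : Finset V) (S : Finset (Finset V)) : Set (Finset V) :=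
  {L | L ⊆ W ∧ ∃ H ∈ S, Disjoint H L}

/-- The chains supported on a family of sets. -/
def chains (K : Type*) [Field K] {V : Type*} (P : Set (Finset V)) : Submodule K (Finset V → K) where
  carrier := {z | ∀ L, L ∉ P → z L = 0}
  zero_mem' := fun _ _ => rfl
  add_mem' := fun {y z} hy hz L hL => by simp [hy L hL, hz L hL]
  smul_mem' := fun c z hz L hL => by simp [hz L hL]

theorem chains_mono {V : Type*} {P Q : Set (Finset V)} (h : P ⊆ Q) : chains K P ≤ chains K Q :=
  fun _ hz L hL => hz L fun hP => hL (h hP)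

theorem isLowerSet_subset {V : Type*} (W : Finset V) : IsLowerSet {L : Finset V | L ⊆ W} :=
  fun _ _ h hW => h.trans hW

theorem single_mem_chains {P : Set (Finset V)} {L : Finset V} (h : L ∈ P) (c : K) :
    Pi.single L c ∈ chains K P := fun T hT =>
  by rw [Pi.single_eq_of_ne]; rintro rfl; exact hT h

variable [Fintype V]

/-! ### The augmented chain complex of the simplex and its cone homotopy -/

/-- The augmented simplicial differential on `⨁_L K e_L`, in coordinates. -/
def simplexD (K : Type*) [Field K] (V : Type*) [LinearOrder V] [Fintype V] :
    (Finset V → K) →ₗ[K] (Finset V → K) where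
  toFun z T := ∑ j ∈ Tᶜ, koszulSign K j T * z (insert j T)
  map_add' y z := by
    ext T; simp [mul_add, Finset.sum_add_distrib]
  map_smul' c z := by
    ext T; simp [Finset.mul_sum, mul_left_comm]

theorem simplexD_apply (z : Finset V → K) (T : Finset V) :
    simplexD K V z T = ∑ j ∈ Tᶜ, koszulSign K j T * z (insert j T) := rfl

theorem simplexD_simplexD (z : Finset V → K) : simplexD K V (simplexD K V z) = 0 := by
  ext T
  simp only [simplexD_apply, Finset.mul_sum, Pi.zero_apply]
  rw [Finset.sum_sigma']
  refine Finset.sum_involution (fun p _ => ⟨p.2, p.1⟩) ?_ ?_ ?_ ?_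
  · rintro ⟨j, k⟩ h
    simp only [Finset.mem_sigma, Finset.mem_compl, Finset.mem_insert, not_or] at h
    obtain ⟨hj, hkj, hk⟩ := h
    dsimp only
    rw [Finset.insert_comm k j]
    rcases lt_or_gt_of_ne hkj with h | h
    · rw [koszulSign_insert_of_lt hk h, koszulSign_insert_of_gt h]; ring
    · rw [koszulSign_insert_of_lt hj h, koszulSign_insert_of_gt h]; ring
  · rintro ⟨j, k⟩ h _ he
    simp only [Finset.mem_sigma, Finset.mem_compl, Finset.mem_insert, not_or] at h
    simp only [Sigma.mk.injEq, heq_eq_eq] at he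
    exact h.2.1 he.1
  · rintro ⟨j, k⟩ h
    simp only [Finset.mem_sigma, Finset.mem_compl, Finset.mem_insert, not_or] at h ⊢
    exact ⟨h.2.2, Ne.symm h.2.1, h.1⟩
  · rintro ⟨j, k⟩ _
    rfl

theorem simplexD_single_erase {L : Finset V} {j : V} (hj : j ∈ L) :
    simplexD K V (Pi.single L 1) (L.erase j) = koszulSign K j (L.erase j) := by
  rw [simplexD_apply, Finset.sum_eq_single j]
  · rw [Finset.insert_erase hj]; simp
  · intro i hi hij
    rw [Pi.single_eq_of_ne, mul_zero]
    intro h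
    have : i ∈ L := h ▸ Finset.mem_insert_self _ _
    simp only [Finset.mem_compl, Finset.mem_erase, not_and] at hi
    exact hi hij this
  · simp

theorem exists_of_simplexD_single_ne_zero {L T : Finset V}
    (h : simplexD K V (Pi.single L 1) T ≠ 0) : ∃ j ∈ L, T = L.erase j := by
  rw [simplexD_apply] at h
  obtain ⟨j, hj, hne⟩ := Finset.exists_ne_zero_of_sum_ne_zero h
  have hL : insert j T = L := by
    by_contra hn
    exact hne (by rw [Pi.single_eq_of_ne hn, mul_zero])
  refine ⟨j, hL ▸ Finset.mem_insert_self _ _, ?_⟩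
  rw [← hL, Finset.erase_insert (by simpa using hj)]

/-- The cone operator `e_L ↦ ± e_{L ∪ {u}}`. -/
def coneMap (u : V) (z : Finset V → K) : Finset V → K :=
  fun T => if u ∈ T then koszulSign K u (T.erase u) * z (T.erase u) else 0

/-- The faces of `e_{L ∪ {u}}` are `e_L` and the cones over the faces of `e_L`; the latter cancel by
`koszulSign_swap`. -/
theorem simplexD_coneMap_add (u : V) (z : Finset V → K) :
    simplexD K V (coneMap u z) + coneMap u (simplexD K V z) = z := by
  ext T
  rw [Pi.add_apply, simplexD_apply]
  by_cases hu : u ∈ T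
  · have hT : T = insert u (T.erase u) := (Finset.insert_erase hu).symm
    have hu' : u ∉ T.erase u := Finset.notMem_erase u T
    generalize T.erase u = S at hT hu'
    subst hT
    have hc : (Sᶜ : Finset V) = insert u (insert u S)ᶜ := by
      ext i; by_cases hi : i = u <;> simp [hi, hu']
    simp only [coneMap, hu, if_true, Finset.erase_insert hu', simplexD_apply]
    rw [hc, Finset.sum_insert (by simp), mul_add, ← mul_assoc, koszulSign_mul_self, one_mul,
      add_left_comm, Finset.mul_sum, ← Finset.sum_add_distrib, Finset.sum_eq_zero, add_zero]
    intro j hj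
    simp only [Finset.mem_compl, Finset.mem_insert, not_or] at hj
    rw [if_pos (by simp), Finset.insert_comm, Finset.erase_insert (by simp [hu', Ne.symm hj.1]),
      ← mul_assoc, koszulSign_swap hu' hj.2 (Ne.symm hj.1)]
    ring
  · simp only [coneMap, hu, if_false, add_zero]
    rw [Finset.sum_eq_single u]
    · rw [if_pos (by simp), Finset.erase_insert hu, ← mul_assoc, koszulSign_mul_self, one_mul]
    · intro j _ hj
      rw [if_neg (by simp [hu, Ne.symm hj]), mul_zero]
    · intro h; exact absurd (Finset.mem_compl.2 hu) h

theorem simplexD_mem_chains {P : Set (Finset V)} (hP : IsLowerSet P) {z : Finset V → K}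
    (hz : z ∈ chains K P) : simplexD K V z ∈ chains K P := fun T hT => by
  rw [simplexD_apply]
  refine Finset.sum_eq_zero fun j _ => ?_
  rw [hz _ fun h => hT (hP (Finset.subset_insert j T) h), mul_zero]

/-! ### Relative homology with a monomial generator -/

/-- Cycles of the simplex on `W` relative to the family `N`. -/
def relCycles (K : Type*) [Field K] {V : Type*} [LinearOrder V] [Fintype V] (W : Finset V)
    (N : Set (Finset V)) : Submodule K (Finset V → K) :=
  chains K {L | L ⊆ W} ⊓ (chains K N).comap (simplexD K V)

/-- Boundaries of the simplex on `W` relative to the family `N`. -/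
def relBoundaries (K : Type*) [Field K] {V : Type*} [LinearOrder V] [Fintype V] (W : Finset V)
    (N : Set (Finset V)) : Submodule K (Finset V → K) :=
  (chains K {L | L ⊆ W}).map (simplexD K V) ⊔ chains K N

theorem relBoundaries_mono {W : Finset V} {N N' : Set (Finset V)} (h : N ⊆ N') :
    relBoundaries K W N ≤ relBoundaries K W N' :=
  sup_le_sup_left (chains_mono h) _

/-- In the homotopy identity `z = d (cone z) + cone (d z)` the last term stays in `N`, because `N`
is stable under adding `u`. -/
theorem relCycles_le_relBoundaries_of_cone {W : Finset V} {N : Set (Finset V)} {u : V} (hu : u ∈ W)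
    (hN : ∀ L ∈ N, insert u L ∈ N) : relCycles K W N ≤ relBoundaries K W N := by
  have key : ∀ {P : Set (Finset V)} {z : Finset V → K}, (∀ L ∈ P, insert u L ∈ P) →
      z ∈ chains K P → coneMap u z ∈ chains K P := by
    intro P z hP hz T hT
    unfold coneMap
    split_ifs with h
    · rw [hz, mul_zero]
      intro h'
      exact hT (by simpa [Finset.insert_erase h] using hP _ h')
    · rfl
  intro z hz
  rw [← simplexD_coneMap_add u z]
  exact Submodule.add_mem_sup
    (Submodule.mem_map_of_mem (key (fun L hL => Finset.insert_subset hu hL) hz.1)) (key hN hz.2)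

/-- The relative homology of the simplex on `W` modulo `N` is spanned by the class of a single
`e_L`, and the class of every `e_L` that is a cycle is `0` or this generator up to sign. -/
def HasMonomialGenerator (K : Type*) [Field K] {V : Type*} [LinearOrder V] [Fintype V]
    (W : Finset V) (N : Set (Finset V)) : Prop :=
  ∃ L₀ : Finset V, Pi.single L₀ 1 ∈ relCycles K W N ∧
    (∀ z ∈ relCycles K W N, ∃ c : K, z - c • Pi.single L₀ 1 ∈ relBoundaries K W N) ∧
    ∀ L : Finset V, Pi.single L 1 ∈ relCycles K W N →
      ∃ ε : K, (ε = 0 ∨ ε = 1 ∨ ε = -1) ∧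
        Pi.single L 1 - ε • Pi.single L₀ 1 ∈ relBoundaries K W N

theorem single_empty_mem_relCycles (W : Finset V) (N : Set (Finset V)) :
    Pi.single ∅ 1 ∈ relCycles K W N := by
  refine ⟨single_mem_chains (Finset.empty_subset W) 1, ?_⟩
  have : simplexD K V (Pi.single ∅ 1) = 0 := by
    ext T
    by_contra h
    obtain ⟨j, hj, -⟩ := exists_of_simplexD_single_ne_zero h
    exact Finset.notMem_empty j hj
  change simplexD K V _ ∈ chains K N
  rw [this]
  exact zero_mem _

/-- When the homology vanishes, `e_∅` serves as a default generator: it is always a cycle. -/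
theorem hasMonomialGenerator_of_le {W : Finset V} {N : Set (Finset V)}
    (h : relCycles K W N ≤ relBoundaries K W N) : HasMonomialGenerator K W N :=
  ⟨∅, single_empty_mem_relCycles W N, fun z hz => ⟨0, by simpa using h hz⟩,
    fun L hL => ⟨0, Or.inl rfl, by simpa using h hL⟩⟩

theorem hasMonomialGenerator_empty (W : Finset V) : HasMonomialGenerator K W ∅ := by
  rcases W.eq_empty_or_nonempty with rfl | ⟨u, hu⟩
  · refine ⟨∅, single_empty_mem_relCycles ∅ ∅, fun z hz => ⟨z ∅, ?_⟩, fun L hL => ⟨1, by simp, ?_⟩⟩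
    · convert zero_mem (relBoundaries K ∅ ∅) using 1
      ext T
      by_cases hT : T = ∅
      · simp [hT]
      · simp [Pi.single_eq_of_ne hT, hz.1 T (by simpa using hT)]
    · have : L = ∅ := by
        by_contra hn
        have := hL.1 L (by simpa using hn)
        simp at this
      simp [this]
  · exact hasMonomialGenerator_of_le (relCycles_le_relBoundaries_of_cone hu (by simp))

/-- Adding a set `F` with a vertex `u` that is free with respect to `N`. -/
theorem HasMonomialGenerator.union {W F : Finset V} {N : Set (Finset V)} {u : V} (hFW : F ⊆ W)
    (hu : u ∈ F) (hN : IsLowerSet N) (hNu : ∀ L ∈ N, insert u L ∈ N)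
    (h : HasMonomialGenerator K (W \ F) (N ∩ {L | L ⊆ W \ F})) :
    HasMonomialGenerator K W (N ∪ {L | L ⊆ W \ F}) := by
  -- Injectivity of the connecting map. If `d z ≡ y` modulo `N` and `y = d w + m`, then `z - w` is a
  -- cycle relative to the cone `N`, hence a boundary, while `w` lives on `W \ F`.
  have lift : ∀ {z y : Finset V → K}, z ∈ chains K {L | L ⊆ W} →
      y ∈ relBoundaries K (W \ F) (N ∩ {L | L ⊆ W \ F}) → simplexD K V z - y ∈ chains K N →
      z ∈ relBoundaries K W (N ∪ {L | L ⊆ W \ F}) := by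
    intro z y hz hy hzy
    obtain ⟨_, ⟨w, hw, rfl⟩, m, hm, rfl⟩ := Submodule.mem_sup.1 hy
    have hzw : z - w ∈ relCycles K W N := by
      refine ⟨sub_mem hz (chains_mono (fun L hL => hL.trans Finset.sdiff_subset) hw), ?_⟩
      change simplexD K V _ ∈ chains K N
      rw [map_sub]
      convert add_mem hzy (chains_mono Set.inter_subset_left hm) using 1
      abel
    have := relBoundaries_mono (K := K) (Set.subset_union_left (t := {L | L ⊆ W \ F}))
      (relCycles_le_relBoundaries_of_cone (hFW hu) hNu hzw)
    simpa using add_mem this (Submodule.mem_sup_right (chains_mono Set.subset_union_right hw))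
  -- The connecting map lands in cycles: `d y = -d (d z - y)` is supported in `N` and also on `W \
  -- F`.
  have cyc : ∀ {z y : Finset V → K}, y ∈ chains K {L | L ⊆ W \ F} →
      simplexD K V z - y ∈ chains K N → y ∈ relCycles K (W \ F) (N ∩ {L | L ⊆ W \ F}) := by
    intro z y hy hzy
    refine ⟨hy, ?_⟩
    have h1 := simplexD_mem_chains hN hzy
    rw [map_sub, simplexD_simplexD, zero_sub, neg_mem_iff] at h1
    have h2 := simplexD_mem_chains (isLowerSet_subset (W \ F)) hy
    intro L hL
    by_cases hLN : L ∈ N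
    · exact h2 L fun h => hL ⟨hLN, h⟩
    · exact h1 L hLN
  obtain ⟨L₀, hL₀, hspan, hmon⟩ := h
  have hL₀W : L₀ ⊆ W \ F := by
    by_contra hn
    have := hL₀.1 L₀ hn
    simp at this
  have huL₀ : u ∉ L₀ := fun hn => (Finset.mem_sdiff.1 (hL₀W hn)).2 hu
  -- Surjectivity: `e_{L₀ ∪ {u}}` maps to `± e_{L₀}`. Its remaining faces are cones over the faces
  -- of `L₀`, which lie in `N` because `e_{L₀}` is a relative cycle.
  have hins : simplexD K V (Pi.single (insert u L₀) 1) - koszulSign K u L₀ • Pi.single L₀ 1 ∈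
      chains K N := by
    intro T hT
    rw [Pi.sub_apply, Pi.smul_apply, smul_eq_mul]
    by_cases hTL : T = L₀
    · subst hTL
      have := simplexD_single_erase (K := K) (Finset.mem_insert_self u T)
      rw [Finset.erase_insert huL₀] at this
      simp [this]
    · rw [Pi.single_eq_of_ne hTL, mul_zero, sub_zero]
      by_contra hne
      obtain ⟨j, hj, rfl⟩ := exists_of_simplexD_single_ne_zero hne
      rcases Finset.mem_insert.1 hj with rfl | hj
      · exact hTL (Finset.erase_insert huL₀)
      · apply hT
        rw [Finset.erase_insert_of_ne (by rintro rfl; exact huL₀ hj)]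
        apply hNu
        by_contra hn
        have h1 := hL₀.2 (L₀.erase j) fun h => hn h.1
        rw [simplexD_single_erase hj] at h1
        rcases koszulSign_eq (K := K) j (L₀.erase j) with h | h <;> simp [h] at h1
  have hins' : Pi.single (insert u L₀) (1 : K) ∈ chains K {L | L ⊆ W} :=
    single_mem_chains (Finset.insert_subset (hFW hu) (hL₀W.trans Finset.sdiff_subset)) 1
  have step : ∀ {z y : Finset V → K} {c : K}, z ∈ chains K {L | L ⊆ W} →
      simplexD K V z - y ∈ chains K N →
      y - c • Pi.single L₀ 1 ∈ relBoundaries K (W \ F) (N ∩ {L | L ⊆ W \ F}) →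
      z - (c * koszulSign K u L₀) • Pi.single (insert u L₀) 1 ∈
        relBoundaries K W (N ∪ {L | L ⊆ W \ F}) := by
    intro z y c hz hzy hy
    refine lift (sub_mem hz (Submodule.smul_mem _ _ hins')) hy ?_
    convert sub_mem hzy (Submodule.smul_mem _ (c * koszulSign K u L₀) hins) using 1
    rw [map_sub, map_smul, smul_sub, smul_smul, mul_assoc, koszulSign_mul_self, mul_one]
    abel
  refine ⟨insert u L₀, ⟨hins', ?_⟩, ?_, ?_⟩
  · change simplexD K V _ ∈ chains K _
    rw [← sub_add_cancel (simplexD K V _) (koszulSign K u L₀ • Pi.single L₀ 1)]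
    exact add_mem (chains_mono Set.subset_union_left hins)
      (Submodule.smul_mem _ _ (single_mem_chains (Or.inr hL₀W) 1))
  · intro z hz
    classical
    -- The image of `z` under the connecting map: the part of `d z` off `F`, the rest lying in `N`.
    let y : Finset V → K := fun T => if T ⊆ W \ F then simplexD K V z T else 0
    have hy : y ∈ chains K {L | L ⊆ W \ F} := fun T hT => if_neg hT
    have hzy : simplexD K V z - y ∈ chains K N := by
      intro T hT
      by_cases h : T ⊆ W \ F
      · simp [y, h]
      · simpa [y, h] using hz.2 T (by simp [hT, h])
    obtain ⟨c, hc⟩ := hspan y (cyc hy hzy)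
    exact ⟨_, step hz.1 hzy hc⟩
  · intro L hL
    have hLW : L ⊆ W := by
      by_contra hn
      have := hL.1 L hn
      simp at this
    -- A face of `L` can miss `F` only if `L` has at most one vertex in `F`. With exactly one vertex
    -- `j`, the connecting map gives `± e_{L \ {j}}`; with none, `e_L` is zero in the quotient; with
    -- two or more, `d e_L` lies in `N` and `lift` applies with `y = 0`.
    by_cases hLF : ∃ j, L ∩ F = {j}
    · obtain ⟨j, hj⟩ := hLF
      have hjm : j ∈ L ∩ F := hj ▸ Finset.mem_singleton_self j
      have hjL := (Finset.mem_inter.1 hjm).1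
      have hsub : L.erase j ⊆ W \ F := by
        intro i hi
        rw [Finset.mem_erase] at hi
        refine Finset.mem_sdiff.2 ⟨hLW hi.2, fun hiF => hi.1 ?_⟩
        exact Finset.mem_singleton.1 (hj ▸ Finset.mem_inter.2 ⟨hi.2, hiF⟩)
      have hy : koszulSign K j (L.erase j) • Pi.single (L.erase j) (1 : K) ∈
          chains K {L | L ⊆ W \ F} := Submodule.smul_mem _ _ (single_mem_chains hsub 1)
      have hzy : simplexD K V (Pi.single L 1) -
          koszulSign K j (L.erase j) • Pi.single (L.erase j) (1 : K) ∈ chains K N := by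
        intro T hT
        rw [Pi.sub_apply, Pi.smul_apply, smul_eq_mul]
        by_cases hTL : T = L.erase j
        · simp [hTL, simplexD_single_erase hjL]
        · rw [Pi.single_eq_of_ne hTL, mul_zero, sub_zero]
          by_contra hne
          obtain ⟨i, hi, rfl⟩ := exists_of_simplexD_single_ne_zero hne
          refine hne (hL.2 _ ?_)
          rintro (h | h)
          · exact hT h
          · have hji : j ≠ i := by rintro rfl; exact hTL rfl
            exact (Finset.mem_sdiff.1 (h (Finset.mem_erase.2 ⟨hji, hjL⟩))).2
              (Finset.mem_inter.1 hjm).2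
      have hc := cyc hy hzy
      have hc' : Pi.single (L.erase j) (1 : K) ∈
          relCycles K (W \ F) (N ∩ {L | L ⊆ W \ F}) := by
        have := Submodule.smul_mem _ (koszulSign K j (L.erase j)) hc
        rwa [smul_smul, koszulSign_mul_self, one_smul] at this
      obtain ⟨ε, hε, hB⟩ := hmon _ hc'
      have hB' := Submodule.smul_mem _ (koszulSign K j (L.erase j)) hB
      rw [smul_sub, smul_smul] at hB'
      refine ⟨_, ?_, step hL.1 hzy hB'⟩
      rcases koszulSign_eq (K := K) j (L.erase j) with h | h <;>
      rcases koszulSign_eq (K := K) u L₀ with h' | h' <;>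
      rcases hε with h'' | h'' | h'' <;> simp [h, h', h'']
    · refine ⟨0, Or.inl rfl, ?_⟩
      rw [zero_smul, sub_zero]
      by_cases hLF' : L ∩ F = ∅
      · refine Submodule.mem_sup_right (single_mem_chains (Or.inr ?_) 1)
        exact Finset.subset_sdiff.2 ⟨hLW, Finset.disjoint_iff_inter_eq_empty.2 hLF'⟩
      · refine lift hL.1 (zero_mem _) ?_
        rw [sub_zero]
        intro T hT
        by_contra hne
        obtain ⟨i, hi, rfl⟩ := exists_of_simplexD_single_ne_zero hne
        refine hne (hL.2 _ ?_)
        rintro (h | h)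
        · exact hT h
        · obtain ⟨k, hk⟩ := Finset.nonempty_iff_ne_empty.2 hLF'
          refine hLF ⟨i, ?_⟩
          have hall : ∀ k ∈ L ∩ F, k = i := by
            intro k hk
            by_contra hki
            rw [Finset.mem_inter] at hk
            exact (Finset.mem_sdiff.1 (h (Finset.mem_erase.2 ⟨hki, hk.1⟩))).2 hk.2
          exact Finset.eq_singleton_iff_unique_mem.2 ⟨hall k hk ▸ hk, hall⟩

theorem hasMonomialGenerator_nonCovers (W : Finset V) (S : Finset (Finset V))
    (hSW : ∀ H ∈ S, H ⊆ W) (hS : HasLeaves (S : Set (Finset V))) :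
    HasMonomialGenerator K W (nonCovers W S) := by
  induction hc : S.card using Nat.strong_induction_on generalizing W S with
  | _ c ih =>
  subst hc
  rcases S.eq_empty_or_nonempty with rfl | hne
  · convert hasMonomialGenerator_empty (K := K) W
    simp [nonCovers]
  obtain ⟨F, hF, hleaf⟩ := hS S subset_rfl hne
  have hF : F ∈ S := hF
  by_cases hF0 : F = ∅
  · subst hF0
    refine hasMonomialGenerator_of_le fun z hz => Submodule.mem_sup_right fun L hL => hz.1 L ?_
    exact fun hLW => hL ⟨hLW, ∅, hF, Finset.disjoint_empty_left L⟩
  -- A member `G` containing `F` is redundant: a set that misses `G` misses `F`.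
  by_cases hG : ∃ G ∈ S, G ≠ F ∧ F ⊆ G
  · obtain ⟨G, hG, hGF, hsub⟩ := hG
    have := ih _ (Finset.card_erase_lt_of_mem hG) W (S.erase G)
      (fun H hH => hSW H (Finset.mem_of_mem_erase hH))
      (hS.mono (by exact_mod_cast Finset.erase_subset G S)) rfl
    convert this using 1
    ext L
    refine and_congr_right fun _ => ⟨?_, fun ⟨H, hH, hd⟩ => ⟨H, Finset.mem_of_mem_erase hH, hd⟩⟩
    rintro ⟨H, hH, hd⟩
    by_cases hHG : H = G
    · subst hHG
      exact ⟨F, Finset.mem_erase.2 ⟨Ne.symm hGF, hF⟩, hd.mono_left hsub⟩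
    · exact ⟨H, Finset.mem_erase.2 ⟨hHG, hH⟩, hd⟩
  obtain ⟨u, hu, hfree⟩ : ∃ u ∈ F, ∀ H ∈ S.erase F, u ∉ H := by
    rcases hleaf with h | ⟨G, hGS, hGF, h⟩
    · obtain ⟨u, hu⟩ := Finset.nonempty_iff_ne_empty.2 hF0
      exact ⟨u, hu, fun H hH => absurd (h H (Finset.mem_of_mem_erase hH)) (Finset.ne_of_mem_erase hH)⟩
    -- By the leaf condition, a vertex of `F` outside `G` lies in no other member.
    · have hn : ¬ F ⊆ G := fun h => hG ⟨G, hGS, hGF, h⟩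
      obtain ⟨u, hu, huG⟩ := Finset.not_subset.1 hn
      refine ⟨u, hu, fun H hH huH => huG ?_⟩
      exact (Finset.mem_inter.1 (h H (Finset.mem_of_mem_erase hH) (Finset.ne_of_mem_erase hH)
        (Finset.mem_inter.2 ⟨hu, huH⟩))).2
  have hcard : ((S.erase F).image (· ∩ Fᶜ)).card < S.card :=
    Finset.card_image_le.trans_lt (Finset.card_erase_lt_of_mem hF)
  have key := ih _ hcard (W \ F) ((S.erase F).image (· ∩ Fᶜ)) (by
      intro H hH
      obtain ⟨P, hP, rfl⟩ := Finset.mem_image.1 hH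
      intro i hi
      have := @hSW P (Finset.mem_of_mem_erase hP) i
      simp only [Finset.mem_inter, Finset.mem_compl, Finset.mem_sdiff] at hi ⊢
      tauto) (by
      rw [Finset.coe_image]
      exact (hS.mono (by exact_mod_cast Finset.erase_subset F S)).image_inter _) rfl
  have e1 : nonCovers (W \ F) ((S.erase F).image (· ∩ Fᶜ)) =
      nonCovers W (S.erase F) ∩ {L | L ⊆ W \ F} := by
    ext L
    simp only [nonCovers, Set.mem_ofPred_eq, Set.mem_inter_iff, Finset.exists_mem_image]
    constructor
    · rintro ⟨hL, H, hH, hd⟩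
      refine ⟨⟨hL.trans Finset.sdiff_subset, H, hH, ?_⟩, hL⟩
      rw [Finset.disjoint_left] at hd ⊢
      exact fun i hi hiL => hd (Finset.mem_inter.2
        ⟨hi, Finset.mem_compl.2 (Finset.mem_sdiff.1 (hL hiL)).2⟩) hiL
    · rintro ⟨⟨-, H, hH, hd⟩, hL⟩
      exact ⟨hL, H, hH, hd.mono_left Finset.inter_subset_left⟩
  have e2 : nonCovers W S = nonCovers W (S.erase F) ∪ {L | L ⊆ W \ F} := by
    ext L
    simp only [nonCovers, Set.mem_ofPred_eq, Set.mem_union, Finset.subset_sdiff]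
    constructor
    · rintro ⟨hL, H, hH, hd⟩
      by_cases hHF : H = F
      · exact Or.inr ⟨hL, hHF ▸ hd.symm⟩
      · exact Or.inl ⟨hL, H, Finset.mem_erase.2 ⟨hHF, hH⟩, hd⟩
    · rintro (⟨hL, H, hH, hd⟩ | ⟨hL, hd⟩)
      · exact ⟨hL, H, Finset.mem_of_mem_erase hH, hd⟩
      · exact ⟨hL, F, hF, hd.symm⟩
  rw [e1] at key
  rw [e2]
  refine HasMonomialGenerator.union (hSW F hF) hu ?_ ?_ key
  · rintro L L' hle ⟨hL, H, hH, hd⟩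
    exact ⟨hle.trans hL, H, hH, hd.mono_right hle⟩
  · rintro L ⟨hL, H, hH, hd⟩
    exact ⟨Finset.insert_subset (hSW F hF hu) hL, H, hH,
      Finset.disjoint_insert_right.2 ⟨hfree H hH, hd⟩⟩

end Simplex

theorem koszulD_apply {K : Type*} [Field K] {n : ℕ} {M : Type*} [AddCommGroup M]
    [Module (MvPolynomial (Fin n) K) M] (z : Finset (Fin n) → M) (T : Finset (Fin n)) :
    koszulD K n M z T = ∑ j ∈ Tᶜ,
      (koszulSign (MvPolynomial (Fin n) K) j T * X j) • z (insert j T) := by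
  simp only [koszulD, LinearMap.sum_apply, LinearMap.smul_apply, LinearMap.comp_apply,
    LinearMap.proj_apply, LinearMap.single_apply, Finset.sum_apply, Pi.smul_apply]
  rw [Finset.sum_comm' (t' := Finset.univ) (s' := fun j => Finset.univ.filter (j ∈ ·)) (by simp)]
  symm
  refine (Finset.sum_congr rfl fun j hj => ?_).trans
    (Finset.sum_subset (Finset.subset_univ Tᶜ) fun j _ hj => ?_)
  · rw [Finset.mem_compl] at hj
    rw [Finset.sum_eq_single (insert j T)]
    · rw [Finset.erase_insert hj, Pi.single_eq_same, Finset.filter_insert, if_neg (lt_irrefl j)]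
      rfl
    · intro L hL hne
      rw [Pi.single_eq_of_ne, smul_zero]
      rintro rfl
      exact hne (Finset.insert_erase (Finset.mem_filter.1 hL).2).symm
    · simp
  · refine Finset.sum_eq_zero fun L _ => ?_
    rw [Pi.single_eq_of_ne, smul_zero]
    rintro rfl
    simp at hj

/-! ### Multigraded strands of the Koszul complex -/

section Strand

variable {K : Type*} [Field K] {n : ℕ}

/-- The exponent of the squarefree monomial `∏ i ∈ L, x_i`. -/
noncomputable def sqfreeExp (L : Finset (Fin n)) : Fin n →₀ ℕ :=
  ∑ i ∈ L, Finsupp.single i 1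

theorem sqfreeExp_apply (L : Finset (Fin n)) (i : Fin n) :
    sqfreeExp L i = if i ∈ L then 1 else 0 := by
  simp [sqfreeExp, Finsupp.finsetSum_apply, Finsupp.single_apply]

theorem sqfreeExp_le_iff {L : Finset (Fin n)} {b : Fin n →₀ ℕ} :
    sqfreeExp L ≤ b ↔ L ⊆ b.support := by
  simp only [Finsupp.le_def, sqfreeExp_apply, Finset.subset_iff, Finsupp.mem_support_iff]
  refine forall_congr' fun i => ?_
  by_cases h : i ∈ L <;> simp [h]
  omega

theorem mem_span_prod_X_iff {S : Set (Finset (Fin n))} {f : MvPolynomial (Fin n) K} :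
    f ∈ Ideal.span {f : MvPolynomial (Fin n) K | ∃ F ∈ S, f = ∏ i ∈ F, X i} ↔
      ∀ b ∈ f.support, ∃ F ∈ S, F ⊆ b.support := by
  have : {f : MvPolynomial (Fin n) K | ∃ F ∈ S, f = ∏ i ∈ F, X i} =
      (fun s => monomial s (1 : K)) '' (sqfreeExp '' S) := by
    ext f
    simp only [Set.mem_ofPred_eq, Set.mem_image, exists_exists_and_eq_and, sqfreeExp,
      monomial_sum_one]
    exact exists_congr fun F => and_congr_right fun _ => eq_comm
  rw [this, mem_ideal_span_monomial_image]
  simp [sqfreeExp_le_iff]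

theorem insert_subset_support_iff {a : Fin n →₀ ℕ} {T : Finset (Fin n)} {j : Fin n} (hj : j ∉ T) :
    insert j T ⊆ a.support ↔ T ⊆ a.support ∧ j ∈ (a - sqfreeExp T).support := by
  rw [Finset.insert_subset_iff, and_comm]
  simp [sqfreeExp_apply, hj]

theorem sub_sqfreeExp_insert {a : Fin n →₀ ℕ} {T : Finset (Fin n)} {j : Fin n} (hj : j ∉ T) :
    a - sqfreeExp (insert j T) = a - sqfreeExp T - Finsupp.single j 1 := by
  rw [sqfreeExp, Finset.sum_insert hj, add_comm, ← tsub_tsub]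
  rfl

/-- The component of multidegree `a` of a Koszul chain. -/
noncomputable def strandProj (a : Fin n →₀ ℕ) :
    (Finset (Fin n) → MvPolynomial (Fin n) K) →ₗ[K] (Finset (Fin n) → K) where
  toFun z L := if L ⊆ a.support then coeff (a - sqfreeExp L) (z L) else 0
  map_add' y z := by
    ext L; by_cases h : L ⊆ a.support <;> simp [h]
  map_smul' c z := by
    ext L; by_cases h : L ⊆ a.support <;> simp [h]

theorem strandProj_apply (a : Fin n →₀ ℕ) (z : Finset (Fin n) → MvPolynomial (Fin n) K)
    (L : Finset (Fin n)) :
    strandProj a z L = if L ⊆ a.support then coeff (a - sqfreeExp L) (z L) else 0 := rfl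

/-- The inclusion `e_L ↦ x^a / x_L e_L` of the strand of multidegree `a`. -/
noncomputable def strandIncl (a : Fin n →₀ ℕ) :
    (Finset (Fin n) → K) →ₗ[K] (Finset (Fin n) → MvPolynomial (Fin n) K) where
  toFun y L := if L ⊆ a.support then monomial (a - sqfreeExp L) (y L) else 0
  map_add' y z := by
    ext1 L; by_cases h : L ⊆ a.support <;> simp [h]
  map_smul' c z := by
    ext1 L; by_cases h : L ⊆ a.support <;> simp [h, smul_monomial]

theorem strandIncl_apply (a : Fin n →₀ ℕ) (y : Finset (Fin n) → K) (L : Finset (Fin n)) :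
    strandIncl a y L = if L ⊆ a.support then monomial (a - sqfreeExp L) (y L) else 0 := rfl

theorem map_koszulSign {R S : Type*} [Ring R] [Ring S] (f : R →+* S) (j : Fin n)
    (T : Finset (Fin n)) : f (koszulSign R j T) = koszulSign S j T := by
  simp [koszulSign]

/-- The factor `x_j` in the Koszul differential compensates for the passage from `L` to `L \ {j}`,
so multidegree is preserved and only the simplicial signs remain. -/
theorem strandProj_koszulD (a : Fin n →₀ ℕ) (z : Finset (Fin n) → MvPolynomial (Fin n) K) :
    strandProj a (koszulD K n (MvPolynomial (Fin n) K) z) =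
      simplexD K (Fin n) (strandProj a z) := by
  ext T
  rw [simplexD_apply, strandProj_apply, koszulD_apply, coeff_sum]
  split_ifs with hT
  · refine Finset.sum_congr rfl fun j hj => ?_
    rw [Finset.mem_compl] at hj
    rw [strandProj_apply, smul_eq_mul, mul_assoc, ← map_koszulSign C, coeff_C_mul, coeff_X_mul',
      sub_sqfreeExp_insert hj]
    simp only [insert_subset_support_iff hj, hT, true_and]
  · refine (Finset.sum_eq_zero fun j _ => ?_).symm
    rw [strandProj_apply, if_neg fun h => hT ((Finset.subset_insert j T).trans h), mul_zero]

theorem koszulD_strandIncl {a : Fin n →₀ ℕ} {y : Finset (Fin n) → K}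
    (hy : y ∈ chains K {L | L ⊆ a.support}) :
    koszulD K n (MvPolynomial (Fin n) K) (strandIncl a y) =
      strandIncl a (simplexD K (Fin n) y) := by
  ext1 T
  rw [strandIncl_apply, koszulD_apply]
  split_ifs with hT
  · rw [simplexD_apply, map_sum]
    refine Finset.sum_congr rfl fun j hj => ?_
    rw [Finset.mem_compl] at hj
    rw [strandIncl_apply, smul_eq_mul, mul_assoc, ← map_koszulSign C]
    split_ifs with h
    · have hj' := ((insert_subset_support_iff hj).1 h).2
      rw [sub_sqfreeExp_insert hj, X, monomial_mul, C_mul_monomial, one_mul,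
        add_tsub_cancel_of_le]
      rw [Finsupp.single_le_iff]
      exact Nat.one_le_iff_ne_zero.2 (Finsupp.mem_support_iff.1 hj')
    · rw [hy _ h]; simp
  · refine Finset.sum_eq_zero fun j _ => ?_
    rw [strandIncl_apply, if_neg fun h => hT ((Finset.subset_insert j T).trans h), smul_zero]

theorem sqfreeExp_add_injective {a b : Fin n →₀ ℕ} {L : Finset (Fin n)} (ha : L ⊆ a.support)
    (hb : L ⊆ b.support) (h : a - sqfreeExp L = b - sqfreeExp L) : a = b := by
  rw [← tsub_add_cancel_of_le (sqfreeExp_le_iff.2 ha), h,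
    tsub_add_cancel_of_le (sqfreeExp_le_iff.2 hb)]

theorem strandProj_strandIncl {a : Fin n →₀ ℕ} {y : Finset (Fin n) → K}
    (hy : y ∈ chains K {L | L ⊆ a.support}) : strandProj a (strandIncl a y) = y := by
  ext L
  rw [strandProj_apply, strandIncl_apply]
  split_ifs with h
  · rw [coeff_monomial, if_pos rfl]
  · exact (hy L h).symm

theorem strandProj_strandIncl_of_ne {a b : Fin n →₀ ℕ} (hab : a ≠ b) (y : Finset (Fin n) → K) :
    strandProj b (strandIncl a y) = 0 := by
  ext L
  rw [strandProj_apply, strandIncl_apply]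
  split_ifs with h h'
  · rw [coeff_monomial, if_neg fun e => hab (sqfreeExp_add_injective h' h e)]; rfl
  · simp
  · rfl

theorem exists_sum_strandIncl_strandProj (z : Finset (Fin n) → MvPolynomial (Fin n) K) :
    ∃ A : Finset (Fin n →₀ ℕ), ∑ a ∈ A, strandIncl a (strandProj a z) = z := by
  classical
  -- The multidegrees of the terms `x^b e_L` occurring in `z`.
  refine ⟨Finset.univ.biUnion fun L => (z L).support.image (· + sqfreeExp L), ?_⟩
  ext1 L
  ext b
  rw [Finset.sum_apply, coeff_sum]
  have hb : L ⊆ (b + sqfreeExp L).support := sqfreeExp_le_iff.1 le_add_self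
  rw [Finset.sum_eq_single (b + sqfreeExp L)]
  · rw [strandIncl_apply, if_pos hb, strandProj_apply, if_pos hb, add_tsub_cancel_right,
      coeff_monomial, if_pos rfl]
  · intro a _ ha
    rw [strandIncl_apply]
    split_ifs with h
    · rw [coeff_monomial, if_neg]
      intro e
      exact ha (sqfreeExp_add_injective h hb (by rw [e, add_tsub_cancel_right]))
    · simp
  · intro h
    have : coeff b (z L) = 0 := by
      by_contra hne
      exact h (Finset.mem_biUnion.2 ⟨L, Finset.mem_univ L,
        Finset.mem_image_of_mem _ (mem_support_iff.2 hne)⟩)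
    rw [strandIncl_apply, if_pos hb, strandProj_apply, if_pos hb, add_tsub_cancel_right,
      this]
    simp

/-- The sets `L` for which `x^a / x_L` lies in the ideal generated by the `∏ i ∈ F, x_i`,
`F ∈ S`. -/
def strandNonFaces (S : Set (Finset (Fin n))) (a : Fin n →₀ ℕ) : Set (Finset (Fin n)) :=
  {L | L ⊆ a.support ∧ ∃ F ∈ S, F ⊆ (a - sqfreeExp L).support}

/-- Dividing `x^a` by `x_L` removes from the support exactly the vertices of `L` with exponent `1`.
So for `F ⊆ supp a`, the product over `F` divides `x^a / x_L` iff `L` misses the trace of `F` on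
those vertices. -/
theorem hasMonomialGenerator_strandNonFaces {S : Set (Finset (Fin n))} (hS : HasLeaves S)
    (a : Fin n →₀ ℕ) : HasMonomialGenerator K a.support (strandNonFaces S a) := by
  classical
  let A : Finset (Fin n) := Finset.univ.filter (a · = 1)
  let S' : Finset (Finset (Fin n)) :=
    (Finset.univ.filter fun F => F ∈ S ∧ F ⊆ a.support).image (· ∩ A)
  have hS' : HasLeaves (S' : Set (Finset (Fin n))) := by
    rw [Finset.coe_image]
    exact (hS.mono fun F hF => by simp at hF; exact hF.1).image_inter A
  convert hasMonomialGenerator_nonCovers (K := K) a.support S' ?_ hS' using 1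
  · ext L
    refine and_congr_right fun hL => ?_
    simp only [S', Finset.exists_mem_image, Finset.mem_filter, Finset.mem_univ, true_and, and_assoc]
    refine exists_congr fun F => and_congr_right fun _ => ?_
    simp only [Finset.subset_iff, Finset.disjoint_left, A, Finset.mem_inter, Finset.mem_filter,
      Finset.mem_univ, true_and, Finsupp.mem_support_iff, Finsupp.tsub_apply, sqfreeExp_apply,
      ← forall_and]
    refine forall_congr' fun i => ?_
    by_cases hF : i ∈ F <;> by_cases hi : i ∈ L <;> simp [hF, hi]
    omega
  · intro H hH
    obtain ⟨F, hF, rfl⟩ := Finset.mem_image.1 hH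
    exact Finset.inter_subset_left.trans (Finset.mem_filter.1 hF).2.2

theorem strandProj_mem_chains {S : Set (Finset (Fin n))} (a : Fin n →₀ ℕ)
    {z : Finset (Fin n) → MvPolynomial (Fin n) K}
    (hz : ∀ T, z T ∈ Ideal.span {f : MvPolynomial (Fin n) K | ∃ F ∈ S, f = ∏ i ∈ F, X i}) :
    strandProj a z ∈ chains K (strandNonFaces S a) := by
  intro L hL
  rw [strandProj_apply]
  split_ifs with h
  · by_contra hne
    exact hL ⟨h, mem_span_prod_X_iff.1 (hz L) _ (mem_support_iff.2 hne)⟩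
  · rfl

theorem strandIncl_mem {S : Set (Finset (Fin n))} {a : Fin n →₀ ℕ} {y : Finset (Fin n) → K}
    (hy : y ∈ chains K (strandNonFaces S a)) (T : Finset (Fin n)) :
    strandIncl a y T ∈ Ideal.span {f : MvPolynomial (Fin n) K | ∃ F ∈ S, f = ∏ i ∈ F, X i} := by
  classical
  rw [strandIncl_apply]
  split_ifs with h
  · by_cases hT : T ∈ strandNonFaces S a
    · refine mem_span_prod_X_iff.2 fun b hb => ?_
      rw [Finset.mem_singleton.1 (support_monomial_subset hb)]
      exact hT.2
    · rw [hy T hT]; simp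
  · exact zero_mem _

theorem strandProj_mem_relCycles {S : Set (Finset (Fin n))} (a : Fin n →₀ ℕ)
    {z : Finset (Fin n) → MvPolynomial (Fin n) K}
    (hz : ∀ T, koszulD K n (MvPolynomial (Fin n) K) z T ∈
      Ideal.span {f : MvPolynomial (Fin n) K | ∃ F ∈ S, f = ∏ i ∈ F, X i}) :
    strandProj a z ∈ relCycles K a.support (strandNonFaces S a) := by
  refine ⟨fun L hL => if_neg hL, ?_⟩
  change simplexD K (Fin n) _ ∈ chains K _
  rw [← strandProj_koszulD]
  exact strandProj_mem_chains a hz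

theorem exists_koszulD_of_mem_relBoundaries {S : Set (Finset (Fin n))} {a : Fin n →₀ ℕ}
    {y : Finset (Fin n) → K} (hy : y ∈ relBoundaries K a.support (strandNonFaces S a)) :
    ∃ w, ∀ T, (strandIncl a y - koszulD K n (MvPolynomial (Fin n) K) w) T ∈
      Ideal.span {f : MvPolynomial (Fin n) K | ∃ F ∈ S, f = ∏ i ∈ F, X i} := by
  obtain ⟨_, ⟨w, hw, rfl⟩, m, hm, rfl⟩ := Submodule.mem_sup.1 hy
  refine ⟨strandIncl a w, fun T => ?_⟩
  rw [koszulD_strandIncl hw, map_add, add_sub_cancel_left]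
  exact strandIncl_mem hm T

end Strand

/-! ### From forests to families with leaves -/

/-- A leaf of the part of `T` in one component is a leaf of `T`, since facets in other components
are disjoint from it. -/
theorem IsForest.hasLeaves {V : Type*} [LinearOrder V] {Δ : AbstractSimplicialComplex V}
    (hΔ : IsForest Δ) : HasLeaves (facets Δ) := by
  intro T hT ⟨F₀, hF₀⟩
  obtain ⟨F, ⟨hFT, hFΔ, hFl⟩, hF⟩ := (hΔ F₀ (hT hF₀)).2 (T ∩ component (facets Δ) F₀)
    Set.inter_subset_right ⟨F₀, hF₀, hT hF₀, Relation.ReflTransGen.refl⟩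
  have hout : ∀ H ∈ T, H ∉ component (facets Δ) F₀ → F ∩ H = ∅ := by
    intro H hH hHc
    by_contra hne
    exact hHc ⟨hT hH, hFl.tail ⟨hFΔ, hT hH, Finset.nonempty_iff_ne_empty.2 hne⟩⟩
  refine ⟨F, hFT, ?_⟩
  rcases hF with hF | ⟨G, hG, hGF, hF⟩
  · by_cases h : ∀ G ∈ T, G = F
    · exact Or.inl h
    · push Not at h
      obtain ⟨G, hG, hGF⟩ := h
      -- Here `F` is the only member of `T` in its component, so all intersections are empty and any
      -- `G` will do.
      refine Or.inr ⟨G, hG, hGF, fun H hH hHF => ?_⟩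
      rw [hout H hH fun hc => hHF (hF H ⟨hH, hc⟩)]
      exact Finset.empty_subset _
  · refine Or.inr ⟨G, hG.1, hGF, fun H hH hHF => ?_⟩
    by_cases hc : H ∈ component (facets Δ) F₀
    · exact hF H ⟨hH, hc⟩ hHF
    · rw [hout H hH hc]
      exact Finset.empty_subset _

/-! ### Reduction modulo the ideal -/

section Quotient

variable {K : Type*} [Field K] {n : ℕ} (I : Ideal (MvPolynomial (Fin n) K))

/-- The reduction of Koszul chains modulo `I`. -/
noncomputable def reduceChain :
    (Finset (Fin n) → MvPolynomial (Fin n) K) →ₗ[MvPolynomial (Fin n) K]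
      (Finset (Fin n) → MvPolynomial (Fin n) K ⧸ I) :=
  LinearMap.compLeft (Submodule.mkQ I) (Finset (Fin n))

theorem reduceChain_apply (z : Finset (Fin n) → MvPolynomial (Fin n) K) (L : Finset (Fin n)) :
    reduceChain I z L = Ideal.Quotient.mk I (z L) := rfl

theorem reduceChain_surjective : Function.Surjective (reduceChain I) := fun z => by
  choose y hy using fun L => Ideal.Quotient.mk_surjective (z L)
  exact ⟨y, funext hy⟩

theorem reduceChain_eq_zero_iff {z : Finset (Fin n) → MvPolynomial (Fin n) K} :
    reduceChain I z = 0 ↔ ∀ T, z T ∈ I := by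
  simp only [funext_iff, reduceChain_apply, Pi.zero_apply, Ideal.Quotient.eq_zero_iff_mem]

theorem koszulD_reduceChain (z : Finset (Fin n) → MvPolynomial (Fin n) K) :
    koszulD K n (MvPolynomial (Fin n) K ⧸ I) (reduceChain I z) =
      reduceChain I (koszulD K n (MvPolynomial (Fin n) K) z) := by
  ext1 T
  rw [reduceChain_apply, koszulD_apply, koszulD_apply, map_sum]
  rfl

/-- The differential lowers degree by one, so `w` may be truncated to degree `r + 1`. This lets the
strands be treated without regard to homological degree. -/
theorem mem_koszulBoundaries_of_eq {M : Type*} [AddCommGroup M]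
    [Module (MvPolynomial (Fin n) K) M] {r : ℕ} {z w : Finset (Fin n) → M}
    (hz : z ∈ koszulDegree K n M r)
    (h : ∀ T : Finset (Fin n), T.card = r → z T = koszulD K n M w T) :
    z ∈ koszulBoundaries K n M r := by
  refine ⟨fun L => if L.card = r + 1 then w L else 0, fun L hL => if_neg hL, ?_⟩
  ext1 T
  rw [koszulD_apply]
  by_cases hT : T.card = r
  · rw [h T hT, koszulD_apply]
    refine Finset.sum_congr rfl fun j hj => ?_
    rw [if_pos (by rw [Finset.card_insert_of_notMem (Finset.mem_compl.1 hj), hT])]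
  · rw [hz T hT]
    refine Finset.sum_eq_zero fun j hj => ?_
    rw [if_neg, smul_zero]
    rw [Finset.card_insert_of_notMem (Finset.mem_compl.1 hj)]
    omega

theorem mk_eq_zero_iff {r : ℕ} {z : koszulCycles K n (MvPolynomial (Fin n) K ⧸ I) r} :
    (Submodule.Quotient.mk z : KoszulHomology K n (MvPolynomial (Fin n) K ⧸ I) r) = 0 ↔
      (z : Finset (Fin n) → MvPolynomial (Fin n) K ⧸ I) ∈
        koszulBoundaries K n (MvPolynomial (Fin n) K ⧸ I) r :=
  Submodule.Quotient.mk_eq_zero _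

theorem reduceChain_smul (c : K) (z : Finset (Fin n) → MvPolynomial (Fin n) K) :
    reduceChain I (c • z) = c • reduceChain I z :=
  LinearMap.map_smul_of_tower (reduceChain I) c z

theorem koszulD_smul {M : Type*} [AddCommGroup M] [Module (MvPolynomial (Fin n) K) M]
    [Module K M] [IsScalarTower K (MvPolynomial (Fin n) K) M] (c : K) (z : Finset (Fin n) → M) :
    koszulD K n M (c • z) = c • koszulD K n M z :=
  LinearMap.map_smul_of_tower (koszulD K n M) c z

theorem strandIncl_single {a : Fin n →₀ ℕ} {L : Finset (Fin n)} (hL : L ⊆ a.support) (c : K) :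
    strandIncl a (Pi.single L c) = Pi.single L (monomial (a - sqfreeExp L) c) := by
  ext1 T
  rw [strandIncl_apply]
  by_cases hT : T = L
  · subst hT
    rw [if_pos hL, Pi.single_eq_same, Pi.single_eq_same]
  · rw [Pi.single_eq_of_ne hT, Pi.single_eq_of_ne hT, map_zero, ite_self]

theorem reduceChain_single (L : Finset (Fin n)) (f : MvPolynomial (Fin n) K) :
    reduceChain I (Pi.single L f) = Pi.single L (Ideal.Quotient.mk I f) := by
  ext1 T
  rw [reduceChain_apply]
  by_cases hT : T = L
  · subst hT
    rw [Pi.single_eq_same, Pi.single_eq_same]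
  · rw [Pi.single_eq_of_ne hT, Pi.single_eq_of_ne hT, map_zero]

end Quotient

/-! ### Assembling the basis from the strands -/

/-- The Koszul homology modulo an ideal generated by the squarefree monomials of a family with
leaves has a basis of monomial classes. -/
theorem exists_basis_monomialCycleClasses {K : Type*} [Field K] {n : ℕ}
    {S : Set (Finset (Fin n))} (hS : HasLeaves S) {I : Ideal (MvPolynomial (Fin n) K)}
    (hI : I = Ideal.span {f | ∃ F ∈ S, f = ∏ i ∈ F, X i}) (r : ℕ) :
    ∃ B : Set (KoszulHomology K n (MvPolynomial (Fin n) K ⧸ I) r),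
      B ⊆ monomialCycleClasses I r ∧
      (∃ b : Module.Basis B K (KoszulHomology K n (MvPolynomial (Fin n) K ⧸ I) r),
        ∀ v : B, b v = v) ∧
      ∀ v ∈ monomialCycleClasses I r, v = 0 ∨ v ∈ B ∨ -v ∈ B := by
  classical
  choose L₀ hcyc hspan hmon using hasMonomialGenerator_strandNonFaces (K := K) hS
  have hsub : ∀ a, L₀ a ⊆ a.support := by
    intro a
    by_contra hn
    have := (hcyc a).1 (L₀ a) hn
    simp at this
  have lift : ∀ {a : Fin n →₀ ℕ} {y : Finset (Fin n) → K},
      y ∈ relBoundaries K a.support (strandNonFaces S a) → ∃ w, reduceChain I (strandIncl a y) =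
        koszulD K n (MvPolynomial (Fin n) K ⧸ I) w := by
    intro a y hy
    obtain ⟨w, hw⟩ := exists_koszulD_of_mem_relBoundaries hy
    rw [← hI, ← reduceChain_eq_zero_iff, map_sub, sub_eq_zero, ← koszulD_reduceChain] at hw
    exact ⟨_, hw⟩
  have proj : ∀ {z : Finset (Fin n) → MvPolynomial (Fin n) K} (a : Fin n →₀ ℕ),
      reduceChain I z ∈ LinearMap.ker (koszulD K n (MvPolynomial (Fin n) K ⧸ I)) →
      strandProj a z ∈ relCycles K a.support (strandNonFaces S a) := by
    intro z a hz
    rw [LinearMap.mem_ker, koszulD_reduceChain, reduceChain_eq_zero_iff, hI] at hz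
    exact strandProj_mem_relCycles a hz
  let g : (Fin n →₀ ℕ) → Finset (Fin n) → MvPolynomial (Fin n) K := fun a =>
    strandIncl a (Pi.single (L₀ a) 1)
  have hg : ∀ a, reduceChain I (g a) =
      Pi.single (L₀ a) (Ideal.Quotient.mk I (monomial (a - sqfreeExp (L₀ a)) 1)) := by
    intro a
    rw [← reduceChain_single, ← strandIncl_single (hsub a)]
  have hgdeg : ∀ a (T : Finset (Fin n)), T.card ≠ (L₀ a).card → reduceChain I (g a) T = 0 := by
    intro a T hT
    rw [hg, Pi.single_eq_of_ne]
    rintro rfl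
    exact hT rfl
  have hgcyc : ∀ a, (L₀ a).card = r →
      reduceChain I (g a) ∈ koszulCycles K n (MvPolynomial (Fin n) K ⧸ I) r := by
    intro a ha
    refine ⟨fun T hT => hgdeg a T (ha ▸ hT), ?_⟩
    rw [SetLike.mem_coe, LinearMap.mem_ker, koszulD_reduceChain, koszulD_strandIncl (hcyc a).1,
      reduceChain_eq_zero_iff, hI]
    exact strandIncl_mem (hcyc a).2
  -- The multidegrees whose generator has degree `r` and is not a boundary; these index the basis.
  let J : Type := {a : Fin n →₀ ℕ // (L₀ a).card = r ∧
    Pi.single (L₀ a) (1 : K) ∉ relBoundaries K a.support (strandNonFaces S a)}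
  let gc : J → koszulCycles K n (MvPolynomial (Fin n) K ⧸ I) r := fun a =>
    ⟨reduceChain I (g a.1), hgcyc a.1 a.2.1⟩
  let v : J → KoszulHomology K n (MvPolynomial (Fin n) K ⧸ I) r := fun a =>
    Submodule.Quotient.mk (gc a)
  have hv : ∀ (s : Finset J) (c : J → K), ∑ a ∈ s, c a • v a =
      (Submodule.Quotient.mk (∑ a ∈ s, c a • gc a) :
        KoszulHomology K n (MvPolynomial (Fin n) K ⧸ I) r) := by
    intro s c
    exact (map_sum (Submodule.mkQ _) (fun a => c a • gc a) s).symm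
  have hgc : ∀ (s : Finset J) (c : J → K),
      ((∑ a ∈ s, c a • gc a : koszulCycles K n (MvPolynomial (Fin n) K ⧸ I) r) :
        Finset (Fin n) → MvPolynomial (Fin n) K ⧸ I) = reduceChain I (∑ a ∈ s, c a • g a.1) := by
    intro s c
    rw [Submodule.coe_sum, map_sum]
    exact Finset.sum_congr rfl fun a _ => (reduceChain_smul I (c a) (g a.1)).symm
  -- Projecting a relation to the strand `b` leaves only its `b`-th term, which would make that
  -- generator a boundary.
  have hli : LinearIndependent K v := by
    rw [linearIndependent_iff']
    intro s c hsum b hb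
    rw [hv, mk_eq_zero_iff, hgc] at hsum
    obtain ⟨w, -, hw⟩ := hsum
    obtain ⟨w, rfl⟩ := reduceChain_surjective I w
    rw [koszulD_reduceChain, eq_comm, ← sub_eq_zero, ← map_sub, reduceChain_eq_zero_iff, hI] at hw
    have h := strandProj_mem_chains b.1 hw
    have hpg : strandProj b.1 (∑ a ∈ s, c a • g a.1) = c b • Pi.single (L₀ b.1) 1 := by
      rw [map_sum, Finset.sum_eq_single b]
      · rw [map_smul, strandProj_strandIncl (hcyc b.1).1]
      · intro a _ hab
        rw [map_smul, strandProj_strandIncl_of_ne fun e => hab (Subtype.ext e), smul_zero]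
      · exact fun h => absurd hb h
    rw [map_sub, hpg, strandProj_koszulD] at h
    by_contra hne
    apply b.2.2
    have hB : c b • Pi.single (L₀ b.1) (1 : K) ∈
        relBoundaries K b.1.support (strandNonFaces S b.1) := by
      rw [← sub_add_cancel (c b • Pi.single (L₀ b.1) (1 : K))
        (simplexD K (Fin n) (strandProj b.1 w))]
      exact add_mem (Submodule.mem_sup_right h) (Submodule.mem_sup_left
        (Submodule.mem_map_of_mem fun L hL => if_neg hL))
    exact (Submodule.smul_mem_iff _ hne).1 hB
  have hsp : ⊤ ≤ Submodule.span K (Set.range v) := by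
    rintro x -
    obtain ⟨z, rfl⟩ := Submodule.Quotient.mk_surjective _ x
    obtain ⟨y, hy⟩ := reduceChain_surjective I z.1
    -- Coefficients are set to zero where the generator bounds, so that in degree `r` only indices
    -- in `J` contribute.
    have hc : ∀ a, ∃ c : K, (strandProj a y - c • Pi.single (L₀ a) 1 ∈
        relBoundaries K a.support (strandNonFaces S a)) ∧ (c ≠ 0 →
        Pi.single (L₀ a) (1 : K) ∉ relBoundaries K a.support (strandNonFaces S a)) := by
      intro a
      obtain ⟨c, hc⟩ := hspan a _ (proj (z := y) a (hy ▸ z.2.2))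
      by_cases h : Pi.single (L₀ a) (1 : K) ∈ relBoundaries K a.support (strandNonFaces S a)
      · refine ⟨0, ?_, fun h => absurd rfl h⟩
        simpa using add_mem hc (Submodule.smul_mem _ c h)
      · exact ⟨c, hc, fun _ => h⟩
    choose c hc hcJ using hc
    choose w hw using fun a => lift (hc a)
    obtain ⟨A, hA⟩ := exists_sum_strandIncl_strandProj y
    have hz : z.1 = ∑ a ∈ A, c a • reduceChain I (g a) +
        koszulD K n (MvPolynomial (Fin n) K ⧸ I) (∑ a ∈ A, w a) := by
      rw [← hy, ← hA, map_sum, map_sum, ← Finset.sum_add_distrib]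
      refine Finset.sum_congr rfl fun a _ => ?_
      rw [← hw, map_sub, map_sub, map_smul, reduceChain_smul]
      abel
    let s : Finset J := A.subtype _
    suffices h : (Submodule.Quotient.mk z :
        KoszulHomology K n (MvPolynomial (Fin n) K ⧸ I) r) = ∑ a ∈ s, c a.1 • v a by
      rw [h]
      exact Submodule.sum_mem _ fun a _ =>
        Submodule.smul_mem _ _ (Submodule.subset_span ⟨a, rfl⟩)
    rw [hv, ← sub_eq_zero, ← Submodule.Quotient.mk_sub, mk_eq_zero_iff]
    refine mem_koszulBoundaries_of_eq (w := ∑ a ∈ A, w a) (z - ∑ a ∈ s, c a.1 • gc a).2.1 ?_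
    intro T hT
    rw [Submodule.coe_sub, hgc, hz, Pi.sub_apply, Pi.add_apply, add_comm, add_sub_assoc,
      add_eq_left, sub_eq_zero, map_sum, Finset.sum_apply, Finset.sum_apply]
    refine (Finset.sum_filter_of_ne fun a _ ha => ?_).symm.trans
      (Finset.sum_subtype_eq_sum_filter (s := A)
        (p := fun a => (L₀ a).card = r ∧
          Pi.single (L₀ a) (1 : K) ∉ relBoundaries K a.support (strandNonFaces S a))
        fun a => (c a • reduceChain I (g a)) T).symm |>.trans ?_
    · rw [Pi.smul_apply] at ha
      refine ⟨?_, hcJ a fun h => ha (by rw [h, zero_smul])⟩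
      by_contra hr
      exact ha (by rw [hgdeg a T (hT ▸ Ne.symm hr), smul_zero])
    · exact Finset.sum_congr rfl fun a _ => by rw [reduceChain_smul]
  obtain ⟨bas, hbas⟩ : ∃ bas : Module.Basis J K
      (KoszulHomology K n (MvPolynomial (Fin n) K ⧸ I) r), ∀ a, bas a = v a :=
    ⟨Module.Basis.mk hli hsp, fun a => Module.Basis.mk_apply hli hsp a⟩
  refine ⟨Set.range bas, ?_, ⟨bas.reindexRange, ?_⟩, ?_⟩
  · rintro _ ⟨a, rfl⟩
    exact ⟨_, L₀ a.1, gc a, a.2.1, hg a.1, hbas a⟩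
  · rintro ⟨_, a, rfl⟩
    exact bas.reindexRange_self a
  · rintro _ ⟨b, L, z, hL, hz, rfl⟩
    -- The multidegree of `x^b e_L`.
    set a := b + sqfreeExp L with ha
    have hLa : L ⊆ a.support := sqfreeExp_le_iff.1 le_add_self
    have hz' : z.1 = reduceChain I (strandIncl a (Pi.single L 1)) := by
      rw [hz, strandIncl_single hLa, reduceChain_single, ha, add_tsub_cancel_right]
    have hcL := proj (z := strandIncl a (Pi.single L 1)) a (hz' ▸ z.2.2)
    rw [strandProj_strandIncl (single_mem_chains hLa 1)] at hcL
    obtain ⟨ε, hε, hB⟩ := hmon a L hcL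
    by_cases h : ε ≠ 0 ∧ (L₀ a).card = r ∧
      Pi.single (L₀ a) (1 : K) ∉ relBoundaries K a.support (strandNonFaces S a)
    · obtain ⟨hε0, hJ⟩ := h
      have key : (Submodule.Quotient.mk z :
          KoszulHomology K n (MvPolynomial (Fin n) K ⧸ I) r) = ε • v ⟨a, hJ⟩ := by
        obtain ⟨w, hw⟩ := lift hB
        rw [← sub_eq_zero]
        refine (mk_eq_zero_iff I (z := z - ε • gc ⟨a, hJ⟩)).2
          (mem_koszulBoundaries_of_eq (z - ε • gc ⟨a, hJ⟩).2.1 (w := w) fun T _ => ?_)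
        rw [← hw, map_sub, map_sub, map_smul, reduceChain_smul, ← hz']
        rfl
      rcases hε with rfl | rfl | rfl
      · exact absurd rfl hε0
      · exact Or.inr (Or.inl ⟨⟨a, hJ⟩, by rw [hbas, key, one_smul]⟩)
      · exact Or.inr (Or.inr ⟨⟨a, hJ⟩, by rw [hbas, key, neg_smul, one_smul, neg_neg]⟩)
    · left
      rw [mk_eq_zero_iff]
      obtain ⟨w, hw⟩ := lift hB
      rw [map_sub, map_sub, map_smul, reduceChain_smul, ← hz'] at hw
      by_cases hr : (L₀ a).card = r
      · by_cases hε0 : ε = 0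
        · refine mem_koszulBoundaries_of_eq z.2.1 (w := w) fun T _ => ?_
          rw [← hw, hε0, zero_smul, sub_zero]
        · have hB' : Pi.single (L₀ a) (1 : K) ∈
              relBoundaries K a.support (strandNonFaces S a) := by
            by_contra hn
            exact h ⟨hε0, hr, hn⟩
          obtain ⟨w', hw'⟩ := lift hB'
          refine mem_koszulBoundaries_of_eq z.2.1 (w := w + ε • w') fun T _ => ?_
          rw [map_add, koszulD_smul, ← hw, ← hw', sub_add_cancel]
      -- The generator lives in a degree other than `r`, so its multiple vanishes at every `T` of
      -- size `r`.
      · refine mem_koszulBoundaries_of_eq z.2.1 (w := w) fun T hT => ?_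
        rw [← hw, Pi.sub_apply, Pi.smul_apply]
        erw [hgdeg a T (by rw [hT]; exact Ne.symm hr)]
        rw [smul_zero, sub_zero]

end FacetIdeal

theorem proposition2p9 {K : Type*} [Field K] {n : ℕ} (Δ : AbstractSimplicialComplex (Fin n))
    (hΔ : FacetIdeal.IsForest Δ) (r : ℕ) :
    ∃ B : Set (FacetIdeal.KoszulHomology K n
        (MvPolynomial (Fin n) K ⧸ FacetIdeal.facetIdeal K Δ) r),
      B ⊆ FacetIdeal.monomialCycleClasses (FacetIdeal.facetIdeal K Δ) r ∧
      (∃ b : Module.Basis B K (FacetIdeal.KoszulHomology K n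
          (MvPolynomial (Fin n) K ⧸ FacetIdeal.facetIdeal K Δ) r), ∀ v : B, b v = v) ∧
      ∀ v ∈ FacetIdeal.monomialCycleClasses (FacetIdeal.facetIdeal K Δ) r,
        v = 0 ∨ v ∈ B ∨ -v ∈ B :=
  FacetIdeal.exists_basis_monomialCycleClasses hΔ.hasLeaves rfl r
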